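/- **Conventions.** For finite families of variables $X,Y$ and $k\ge 0$ let $e_k(X/Y)=\sum_{i=0}^k(-1)^{k-i}e_i(X)h_{k-i}(Y)$ and $h_k(X/Y)=\sum_{i=0}^k(-1)^{k-i}h_i(X)e_{k-i}(Y)$, and let both be $0$ for $k<0$. Let $m\ge 0$, and let $x=(x_1,x_2,\dots)$, $\alpha=(\alpha_1,\alpha_2,\dots)$, $\beta=(\beta_1,\beta_2,\dots)$ be elements of a commutative ring (e.g. indeterminates). Write $\mathbf{x}_m=(x_1,\dots,x_m)$, $\boldsymbol\beta_k=(\beta_1,\dots,\beta_k)$, $\overline{\boldsymbol\alpha}_k=(-\alpha_1,\dots,-\alpha_k)$ (empty for $k\le 0$). Let $\mu\subseteq\lambda$ be partitions with conjugates $\mu',\lambda'$, extended by zeros. For any $N\ge\lambda_1$ the dual refined canonical stable Grothendieck polynomial is $$g_{\lambda/\mu}(\mathbf{x}_m;\boldsymbol\alpha,\boldsymbol\beta)=\det\left[e_{\lambda'_i-i-\mu'_j+j}(\mathbf{x}_m,\overline{\boldsymbol\alpha}_{j-1},\boldsymbol\beta_{\lambda'_i-1}\,/\,\overline{\boldsymbol\alpha}_{i-1},\boldsymbol\beta_{\mu'_j})\right]_{1\le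 i,j\le N}.$$ Define doubly infinite sequences $y,z$ by $y_i=x_i,\ z_i=0$ for $1\le i\le m$; $y_i=\beta_{i-m},\ z_i=-\alpha_{i-m}$ for $i>m$; $y_i=-\alpha_{1-i},\ z_i=\beta_{1-i}$ for $i\le 0$. Write $y_{[p,q]}=(y_p,\dots,y_q)$ (empty if $p>q$), and likewise $z_{[p,q]}$. For $k\ge 0$, $c\in\mathbb Z$ and integer vectors $\mathbf p=(p_1,\dots,p_k)$, $\mathbf q=(q_1,\dots,q_k)$, the flagged enumerator of a single row of $k$ cells with contents $c,c+1,\dots,c+k-1$ is $$h^{\mathbf p,\mathbf q}_{k,c}(\mathbf{x}_m;\boldsymbol\alpha,\boldsymbol\beta)=\det\left[e_{1-i+j}\bigl(y_{[p_j,\,q_i]}\,/\,z_{[p_j+c+j-1,\;q_i+c+i-1]}\bigr)\right]_{1\le i,j\le k},$$ which is $1$ for $k=0$; for $k<0$ put $h^{\mathbf p,\mathbf q}_{k,c}=0$. Let $a_i=-i+2$ and $b_i=\lambda'_i+m-1$. For $i,j\ge 1$, the induced flags $\mathbf a^{ij},\mathbf b^{ij}$ of the row with $\lambda_i-\mu_j-i+j$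 cells and first content $\mu_j+1-j$ are defined as follows: for the $r$-th cell, of content $d=\mu_j-j+r$, let $M^{-}$ and $M^{+}$ be the leftmost and the rightmost cell of $\lambda/\mu$ of content $d$ (the content of a cell being column minus row), and set $$a^{ij}_r=a_{\mathrm{col}(M^-)}-(\mu'_{\mathrm{col}(M^-)}+1)+\mathrm{row}(M^-),\qquad b^{ij}_r=b_{\mathrm{col}(M^+)}-\lambda'_{\mathrm{col}(M^+)}+\mathrm{row}(M^+).$$ If $\lambda/\mu$ has no cell of content $d$, set $a^{ij}_r=b^{ij}_r=0$ (this is only a convention, used when $\lambda/\mu$ is disconnected or the matrix below has size $n>\lambda'_1$). **Corollary (Jacobi–Trudi-type formula).** For all partitions $\mu\subseteq\lambda$, all $m\ge 0$ and all $n\ge\lambda'_1$, $$g_{\lambda/\mu}(\mathbf{x}_m;\boldsymbol\alpha,\boldsymbol\beta)=\det\left[h^{\mathbf a^{ij},\mathbf b^{ij}}_{\lambda_i-\mu_j-i+j,\;\mu_j+1-j}(\mathbf{x}_m;\boldsymbol\alpha,\boldsymbol\beta)\right]_{1\le i,j\le n}.$$ Moreover, this formula differs from the known Jacobi–Trudi-type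 formula of Hwang et al.: the matrix above is in general not equal to the matrix $$\left[h_{\lambda_i-\mu_j-i+j}(\mathbf{x}_m,\overline{\boldsymbol\alpha}_{\mu_j},\boldsymbol\beta_{i-1}\,/\,\overline{\boldsymbol\alpha}_{\lambda_i-1},\boldsymbol\beta_{j-1})\right]_{1\le i,j\le n};$$ they already differ for some straight shape ($\mu=\varnothing$), with $n=\lambda'_1$. -/

import Mathlib

namespace DualGroth

/-! Indexing follows the usual mathematical convention: rows, columns, flag entries and matrix
indices start at `1`. Partitions are Mathlib's Young diagrams, whose cells start at `(0, 0)`. -/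

/-- The part `λ_i` (for `i ≥ 1`), equal to `0` beyond the length. -/
def part (lam : YoungDiagram) (i : ℕ) : ℕ := lam.rowLen (i - 1)

/-- The part `λ'_i` (for `i ≥ 1`) of the conjugate partition, equal to `0` beyond the length. -/
def conj (lam : YoungDiagram) (i : ℕ) : ℕ := lam.colLen (i - 1)

section Super

variable {R : Type*} [CommRing R]
variable {σ τ : Type*} [Fintype σ] [Fintype τ] [DecidableEq σ] [DecidableEq τ]

/-- The elementary supersymmetric function `e_k(X / Y)` of two finite families of variables,
`∑_{i ≤ k} (-1)^(k-i) e_i(X) h_{k-i}(Y)`, equal to `0` for `k < 0`. -/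
noncomputable def eSuper (X : σ → R) (Y : τ → R) (k : ℤ) : R :=
  if k < 0 then 0
  else ∑ i ∈ Finset.range (k.toNat + 1),
    (-1) ^ (k.toNat - i) * MvPolynomial.aeval X (MvPolynomial.esymm σ ℤ i) *
      MvPolynomial.aeval Y (MvPolynomial.hsymm τ ℤ (k.toNat - i))

/-- The complete homogeneous supersymmetric function `h_k(X / Y)`,
`∑_{i ≤ k} (-1)^(k-i) h_i(X) e_{k-i}(Y)`, equal to `0` for `k < 0`. -/
noncomputable def hSuper (X : σ → R) (Y : τ → R) (k : ℤ) : R :=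
  if k < 0 then 0
  else ∑ i ∈ Finset.range (k.toNat + 1),
    (-1) ^ (k.toNat - i) * MvPolynomial.aeval X (MvPolynomial.hsymm σ ℤ i) *
      MvPolynomial.aeval Y (MvPolynomial.esymm τ ℤ (k.toNat - i))

end Super

section Functions

variable {R : Type*} [CommRing R]

/-- The initial segment of variables `(f_1, …, f_k)`. -/
def seg (f : ℕ → R) (k : ℕ) : Fin k → R := fun p => f (p + 1)

/-- The negated initial segment `(-f_1, …, -f_k)`. -/
def negSeg (f : ℕ → R) (k : ℕ) : Fin k → R := fun p => -f (p + 1)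

/-- The interval of variables `(f_a, …, f_b)`, empty if `a > b`. -/
def interval (f : ℤ → R) (a b : ℤ) : Finset.Icc a b → R := fun p => f p

/-- The dual refined canonical stable Grothendieck polynomial `g_{λ/μ}(x_1, …, x_m; α, β)`, as the
`N × N` determinant (for `N ≥ λ_1`) with entries
`e_{λ'_i - i - μ'_j + j}(x_m, -α_{1..j-1}, β_{1..λ'_i-1} / -α_{1..i-1}, β_{1..μ'_j})`. -/
noncomputable def dualGroth (N : ℕ) (lam mu : YoungDiagram) (m : ℕ) (x α β : ℕ → R) : R :=
  Matrix.det (Matrix.of fun p q : Fin N =>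
    let i : ℕ := p + 1
    let j : ℕ := q + 1
    eSuper
      (Sum.elim (seg x m) (Sum.elim (negSeg α (j - 1)) (seg β (conj lam i - 1))))
      (Sum.elim (negSeg α (i - 1)) (seg β (conj mu j)))
      ((conj lam i : ℤ) - i - conj mu j + j))

/-- The content of the cell `(i, j)` in the r-shape with outer partition `lam` and root content
`r` (the content of the bottom-left cell `(λ'_1, 1)`). -/
def rContent (lam : YoungDiagram) (r : ℤ) (i j : ℤ) : ℤ := j - i + r - 1 + conj lam 1

/-- The conjugate flag entry `a'_j = a_j + c(γ_j)`, where `γ_j = (μ'_j + 1, j)` is the top cell of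
column `j` of the r-shape `(λ/μ, r)`. -/
def conjFlagA (lam mu : YoungDiagram) (r : ℤ) (a : ℕ → ℤ) (j : ℕ) : ℤ :=
  a j + rContent lam r (conj mu j + 1) j

/-- The conjugate flag entry `b'_i = b_i + c(δ_i)`, where `δ_i = (λ'_i, i)` is the bottom cell of
column `i` of the r-shape `(λ/μ, r)`. -/
def conjFlagB (lam : YoungDiagram) (r : ℤ) (b : ℕ → ℤ) (i : ℕ) : ℤ :=
  b i + rContent lam r (conj lam i) i

/-- The flagged supersymmetric Schur function `S^{a,b}_{λ/μ}(y / z)` of the r-shape `(λ/μ, r)`, as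
an `N × N` determinant (for `N ≥ λ_1`) with entries
`e_{λ'_i - i - μ'_j + j}(y_{a_j..b_i} / z_{a'_j..b'_i})`. -/
noncomputable def flaggedSchur (N : ℕ) (lam mu : YoungDiagram) (r : ℤ) (a b : ℕ → ℤ)
    (y z : ℤ → R) : R :=
  Matrix.det (Matrix.of fun p q : Fin N =>
    let i : ℕ := p + 1
    let j : ℕ := q + 1
    eSuper (interval y (a j) (b i))
      (interval z (conjFlagA lam mu r a j) (conjFlagB lam r b i))
      ((conj lam i : ℤ) - i - conj mu j + j))

/-- The `g`-specialization of the variables `y`. -/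
def gY (m : ℕ) (x α β : ℕ → R) (i : ℤ) : R :=
  if i ≤ 0 then -α (-i + 1).toNat
  else if i ≤ m then x i.toNat
  else β (i - m).toNat

/-- The `g`-specialization of the variables `z`. -/
def gZ (m : ℕ) (α β : ℕ → R) (i : ℤ) : R :=
  if i ≤ 0 then β (-i + 1).toNat
  else if i ≤ m then 0
  else -α (i - m).toNat

/-- The flagged dual Grothendieck enumerator of the r-shape `(λ/μ, r)`. -/
noncomputable def flaggedDualGroth (N : ℕ) (lam mu : YoungDiagram) (r : ℤ) (a b : ℕ → ℤ)
    (m : ℕ) (x α β : ℕ → R) : R :=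
  flaggedSchur N lam mu r a b (gY m x α β) (gZ m α β)

/-- The one-row partition `(k)`. -/
def oneRow (k : ℕ) : YoungDiagram := YoungDiagram.ofRowLens [k] (List.pairwise_singleton _ k).sortedGE

/-- The function `h^{a,b}_{k,c}(x_m; α, β)`: the enumerator of the one-row r-shape `(k)` with root
content `c`. It is `1` for `k = 0` (empty shape) and `0` for `k < 0` (undefined shape). -/
noncomputable def hFlag (k c : ℤ) (a b : ℕ → ℤ) (m : ℕ) (x α β : ℕ → R) : R :=
  if k < 0 then 0
  else flaggedDualGroth k.toNat (oneRow k.toNat) ⊥ c a b m x α β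

end Functions

/-- The (finite) set of columns of the cells of the skew shape `λ/μ` that have content `c`. -/
def contentCols (lam mu : YoungDiagram) (c : ℤ) : Finset ℕ :=
  ((lam.cells \ mu.cells).filter fun p => (p.2 : ℤ) - p.1 = c).image fun p => p.2 + 1

/-- The first flag induced by `a` on the one-row ribbon with contents `c, c + 1, …`. Its `r`-th
entry (`r ≥ 1`) is `a_{col(M)} - (μ'_{col(M)} + 1) + row(M)`, where `M` is the leftmost cell of
`λ/μ` with content `d = c + r - 1`; as `d = col(M) - row(M)`, its row is `col(M) - d`.
If no cell of `λ/μ` has content `d`, the entry is set to `0`. -/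
def inducedA (lam mu : YoungDiagram) (a : ℕ → ℤ) (c : ℤ) (r : ℕ) : ℤ :=
  let d : ℤ := c + r - 1
  if h : (contentCols lam mu d).Nonempty then
    let j := (contentCols lam mu d).min' h
    a j - (conj mu j + 1) + (j - d)
  else 0

/-- The second flag induced by `b` on the one-row ribbon with contents `c, c + 1, …`. Its `r`-th
entry (`r ≥ 1`) is `b_{col(M)} - λ'_{col(M)} + row(M)`, where `M` is the rightmost cell of `λ/μ`
with content `d = c + r - 1`. If no cell of `λ/μ` has content `d`, the entry is set to `0`. -/
def inducedB (lam mu : YoungDiagram) (b : ℕ → ℤ) (c : ℤ) (r : ℕ) : ℤ :=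
  let d : ℤ := c + r - 1
  if h : (contentCols lam mu d).Nonempty then
    let j := (contentCols lam mu d).max' h
    b j - conj lam j + (j - d)
  else 0

/-- The column flag `a_i = -i + 2`. -/
def flagA (i : ℕ) : ℤ := -(i : ℤ) + 2

/-- The column flag `b_i = λ'_i + m - 1`. -/
def flagB (lam : YoungDiagram) (m : ℕ) (i : ℕ) : ℤ := (conj lam i : ℤ) + m - 1

/-- The Jacobi–Trudi-type matrix with entries
`h^{a^{ij}, b^{ij}}_{λ_i - μ_j - i + j, μ_j + 1 - j}(x_m; α, β)`, where `a^{ij}, b^{ij}` are the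
flags induced by `a_i = -i + 2`, `b_i = λ'_i + m - 1`. -/
noncomputable def jacobiTrudi {R : Type*} [CommRing R] (n : ℕ) (lam mu : YoungDiagram) (m : ℕ)
    (x α β : ℕ → R) : Matrix (Fin n) (Fin n) R :=
  Matrix.of fun p q =>
    let i : ℕ := p + 1
    let j : ℕ := q + 1
    let c : ℤ := part mu j + 1 - j
    hFlag ((part lam i : ℤ) - part mu j - i + j) c
      (inducedA lam mu flagA c) (inducedB lam mu (flagB lam m) c) m x α β

/-- The previously known Jacobi–Trudi-type matrix of Hwang et al., with entries
`h_{λ_i - μ_j - i + j}(x_m, -α_{1..μ_j}, β_{1..i-1} / -α_{1..λ_i-1}, β_{1..j-1})`. -/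
noncomputable def knownJacobiTrudi {R : Type*} [CommRing R] (n : ℕ) (lam mu : YoungDiagram)
    (m : ℕ) (x α β : ℕ → R) : Matrix (Fin n) (Fin n) R :=
  Matrix.of fun p q =>
    let i : ℕ := p + 1
    let j : ℕ := q + 1
    hSuper
      (Sum.elim (seg x m) (Sum.elim (negSeg α (part mu j)) (seg β (i - 1))))
      (Sum.elim (negSeg α (part lam i - 1)) (seg β (j - 1)))
      ((part lam i : ℤ) - part mu j - i + j)

end DualGroth

namespace DualGroth

/-! ### Supersymmetric functions: reindexing and removal of zero variables. -/

section Supersymmetric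

variable {R : Type*} [CommRing R]
variable {σ σ' τ τ' : Type*} [Fintype σ] [Fintype σ'] [Fintype τ] [Fintype τ']
  [DecidableEq τ] [DecidableEq τ']

/-! The formula is Jacobi's complementary minor theorem for one unitriangular matrix indexed by
contents.

An induced flag entry depends only on the content of its cell, so all flags `a^{ij}`, `b^{ij}` are
windows of two functions `A`, `B` on contents. Let `U` have entries `e_{1+d'-d}(y_{[A(d'),B(d)]} /
z_{[A(d')+d',B(d)+d]})` (`contentEntry`, cut to a finite window in `windowMatrix`). Rows of the
window start at content `1 - n` and columns at `-n`, which makes `U` upper unitriangular. Up to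
sign, an entry of its inverse is a contiguous minor of `U`, that is, some `h^{a,b}_{k,c}`
(`inv_windowMatrix_apply`).

The boundary path of a diagram in an `n × N` box splits the `n + N` positions into vertical steps
(rows) and horizontal steps (columns). The Jacobi–Trudi matrix is, up to transposition and signs,
the submatrix of the inverse of `U` at the vertical steps of `μ` and `λ`; by Jacobi its determinant
is the minor of `U` at the horizontal steps (`det_jacobiTrudi`). The sign `(-1)^{|λ|+|μ|}` of the
two numberings cancels the signs of the cofactors. This half holds for arbitrary `A`, `B`.

That minor is `g_{λ/μ}` (`dualGroth_eq_minor`): the top cell of a nonempty column is the leftmost of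
its content and the bottom cell the rightmost, so `A` and `B` return the column flags there. Empty
columns may give different entries, but there both matrices split into diagonal blocks
(`det_eq_of_split`). Flag values at contents without cells are therefore immaterial.

The two Jacobi–Trudi matrices are told apart by one entry for the shape `(1,1)`. -/

theorem eSuper_of_neg (X : σ → R) (Y : τ → R) {k : ℤ} (hk : k < 0) : eSuper X Y k = 0 :=
  if_pos hk

theorem eSuper_zero (X : σ → R) (Y : τ → R) : eSuper X Y 0 = 1 := by
  simp [eSuper]

theorem aeval_hsymm (Y : τ → R) (n : ℕ) :
    MvPolynomial.aeval Y (MvPolynomial.hsymm τ ℤ n) = ∑ s : Sym τ n, (s.1.map Y).prod := by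
  rw [MvPolynomial.hsymm, map_sum]
  refine Finset.sum_congr rfl fun s _ => ?_
  rw [map_multiset_prod, Multiset.map_map]
  congr 2
  ext t
  simp

/-- Complete homogeneous symmetric polynomials do not change when variables equal to `0` are
added. -/
theorem aeval_hsymm_of_injective (Y : τ → R) (Y' : τ' → R) (ι : τ → τ')
    (hι : Function.Injective ι) (hY : ∀ t, Y' (ι t) = Y t) (h0 : ∀ t ∉ Set.range ι, Y' t = 0)
    (n : ℕ) : MvPolynomial.aeval Y (MvPolynomial.hsymm τ ℤ n) =
      MvPolynomial.aeval Y' (MvPolynomial.hsymm τ' ℤ n) := by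
  rw [aeval_hsymm, aeval_hsymm]
  refine Fintype.sum_of_injective (Sym.map ι) (Sym.map_injective hι n) _ _ (fun s hsr => ?_)
    fun s => ?_
  -- A monomial supported on the range of `ι` lifts to `τ`, contradicting `hsr`; any other contains
  -- a zero variable.
  · by_cases hall : ∀ t ∈ s.1, t ∈ Set.range ι
    · obtain ⟨u, hu⟩ : ∃ u : Multiset τ, u.map ι = s.1 := by
        let _ : CanLift τ' τ ι (· ∈ Set.range ι) := ⟨fun _ h => h⟩
        exact (Multiset.canLift ι (· ∈ Set.range ι)).prf s.1 hall
      refine absurd ⟨⟨u, ?_⟩, ?_⟩ hsr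
      · rw [← Multiset.card_map ι, hu]
        exact s.2
      · exact Subtype.ext hu
    · push Not at hall
      obtain ⟨t, ht, htr⟩ := hall
      exact Multiset.prod_eq_zero (Multiset.mem_map.2 ⟨t, ht, h0 t htr⟩)
  · change (s.1.map Y).prod = ((s.1.map ι).map Y').prod
    rw [Multiset.map_map]
    congr 2
    ext t
    simp [hY]

/-- Injectivity suffices in the `Y` slot because it must absorb the `m` vanishing middle entries of
`z`; the `X` slot is only permuted. -/
theorem eSuper_eq_of_bijective (X : σ → R) (X' : σ' → R) (Y : τ → R) (Y' : τ' → R)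
    (e : σ → σ') (he : Function.Bijective e) (hX : ∀ s, X' (e s) = X s) (ι : τ → τ')
    (hι : Function.Injective ι) (hY : ∀ t, Y' (ι t) = Y t) (h0 : ∀ t ∉ Set.range ι, Y' t = 0)
    (k : ℤ) : eSuper X Y k = eSuper X' Y' k := by
  have hesymm : ∀ i, MvPolynomial.aeval X (MvPolynomial.esymm σ ℤ i) =
      MvPolynomial.aeval X' (MvPolynomial.esymm σ' ℤ i) := by
    intro i
    rw [← MvPolynomial.rename_esymm σ ℤ i (Equiv.ofBijective e he), MvPolynomial.aeval_rename]
    congr 2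
    ext s
    simp [hX]
  simp only [eSuper, hesymm, aeval_hsymm_of_injective Y Y' ι hι hY h0]

end Supersymmetric

/-! ### The specialized sequences `y` and `z`. -/

section Specialization

variable {R : Type*} [CommRing R] (m : ℕ) (x α β : ℕ → R)

theorem gY_neg (p : ℕ) : gY m x α β (-p) = -α (p + 1) := by
  rw [gY, if_pos (by omega)]
  congr 2
  omega

theorem gY_mid {p : ℕ} (hp : p < m) : gY m x α β (p + 1) = x (p + 1) := by
  rw [gY, if_neg (by omega), if_pos (by omega)]
  congr 1

theorem gY_right (p : ℕ) : gY m x α β (m + 1 + p) = β (p + 1) := by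
  rw [gY, if_neg (by omega), if_neg (by omega)]
  congr 1
  omega

theorem gZ_neg (p : ℕ) : gZ m α β (-p) = β (p + 1) := by
  rw [gZ, if_pos (by omega)]
  congr 1
  omega

theorem gZ_mid {p : ℤ} (h1 : 0 < p) (hp : p ≤ m) : gZ m α β p = 0 := by
  rw [gZ, if_neg (by omega), if_pos hp]

theorem gZ_right (p : ℕ) : gZ m α β (m + 1 + p) = -α (p + 1) := by
  rw [gZ, if_neg (by omega), if_neg (by omega)]
  congr 2
  omega

/-- The entries of the matrix defining `g_{λ/μ}`, written in terms of the sequences `y` and `z`. -/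
theorem eSuper_specialization (u v w l : ℕ) (k : ℤ) :
    eSuper (Sum.elim (seg x m) (Sum.elim (negSeg α u) (seg β l)))
        (Sum.elim (negSeg α v) (seg β w)) k =
      eSuper (interval (gY m x α β) (1 - u) (l + m))
        (interval (gZ m α β) (1 - w) (m + v)) k := by
  refine eSuper_eq_of_bijective _ _ _ _
    (Sum.elim
      (fun p : Fin m => ⟨((p : ℕ) : ℤ) + 1, Finset.mem_Icc.2 ⟨by omega, by omega⟩⟩)
      (Sum.elim (fun p : Fin u => ⟨-((p : ℕ) : ℤ), Finset.mem_Icc.2 ⟨by omega, by omega⟩⟩)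
        (fun p : Fin l => ⟨(m : ℤ) + 1 + (p : ℕ), Finset.mem_Icc.2 ⟨by omega, by omega⟩⟩)))
    ⟨?_, ?_⟩ ?_
    (Sum.elim (fun p : Fin v => ⟨(m : ℤ) + 1 + (p : ℕ), Finset.mem_Icc.2 ⟨by omega, by omega⟩⟩)
      (fun p : Fin w => ⟨-((p : ℕ) : ℤ), Finset.mem_Icc.2 ⟨by omega, by omega⟩⟩)) ?_ ?_ ?_ k
  · rintro (p | p | p) (q | q | q) h <;> have h := congrArg Subtype.val h <;>
      simp only [Sum.elim_inl, Sum.elim_inr] at h <;>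
      first
      | (exfalso; omega)
      | (have : p = q := Fin.ext (by omega)
         rw [this])
  · rintro ⟨c, hc⟩
    have hc := Finset.mem_Icc.1 hc
    rcases le_or_gt c 0 with h | h
    · exact ⟨Sum.inr (Sum.inl ⟨(-c).toNat, by omega⟩), Subtype.ext (by simp; omega)⟩
    rcases le_or_gt c m with h' | h'
    · exact ⟨Sum.inl ⟨(c - 1).toNat, by omega⟩, Subtype.ext (by simp; omega)⟩
    · exact ⟨Sum.inr (Sum.inr ⟨(c - m - 1).toNat, by omega⟩), Subtype.ext (by simp; omega)⟩
  · rintro (p | p | p)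
    · exact gY_mid m x α β p.2
    · exact gY_neg m x α β p
    · exact gY_right m x α β p
  · rintro (p | p) (q | q) h <;> have h := congrArg Subtype.val h <;>
      simp only [Sum.elim_inl, Sum.elim_inr] at h <;>
      first
      | (exfalso; omega)
      | (have : p = q := Fin.ext (by omega)
         rw [this])
  · rintro (p | p)
    · exact gZ_right m α β p
    · exact gZ_neg m α β p
  · rintro ⟨c, hc⟩ hr
    have hc := Finset.mem_Icc.1 hc
    have h1 : 0 < c := by
      by_contra h
      exact hr ⟨Sum.inr ⟨(-c).toNat, by omega⟩, Subtype.ext (by simp; omega)⟩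
    refine gZ_mid m α β h1 ?_
    by_contra h
    have h : ¬ c ≤ m := h
    exact hr ⟨Sum.inl ⟨(c - m - 1).toNat, by omega⟩, Subtype.ext (by simp; omega)⟩

end Specialization

/-! ### Determinants: splitting, complementary minors, unitriangular inverses. -/

section Matrices

variable {R : Type*} [CommRing R]

/-- If two square matrices agree away from a set of rows and columns at which both split into
unitriangular diagonal blocks, their determinants agree. -/
theorem det_eq_of_split {N : ℕ} (A B : Matrix (Fin N) (Fin N) R) (bad : Fin N → Prop)
    (hAl : ∀ i, bad i → ∀ r c, i ≤ r → c ≤ i → c < r → A r c = 0)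
    (hBl : ∀ i, bad i → ∀ r c, i ≤ r → c ≤ i → c < r → B r c = 0)
    (hA1 : ∀ i, bad i → A i i = 1) (hB1 : ∀ i, bad i → B i i = 1)
    (hAB : ∀ i j, ¬ bad i → ¬ bad j → A i j = B i j) : A.det = B.det := by
  -- If no `s ≤ i` is moved up to or past `i`, then `σ` preserves both the indices below `i` and
  -- those up to `i`, so it fixes `i`.
  have fixes : ∀ σ : Equiv.Perm (Fin N), ∀ i,
      (∀ s, i ≤ σ s → s ≤ i → s < σ s → False) → σ i = i := by
    intro σ i h
    have hle : ∀ s, s ≤ i → σ s ≤ i := by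
      intro s hs
      by_contra hc
      push Not at hc
      exact h s hc.le hs (hs.trans_lt hc)
    have hlt : ∀ s, s < i → σ s < i := by
      intro s hs
      by_contra hc
      push Not at hc
      exact h s hc hs.le (hs.trans_le hc)
    have himg : (Finset.Iio i).image σ = Finset.Iio i := by
      apply Finset.eq_of_subset_of_card_le
      · intro t ht
        obtain ⟨s, hs, rfl⟩ := Finset.mem_image.1 ht
        exact Finset.mem_Iio.2 (hlt s (Finset.mem_Iio.1 hs))
      · rw [Finset.card_image_of_injective _ σ.injective]
    rcases (hle i le_rfl).lt_or_eq with h1 | h1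
    · have : σ i ∈ (Finset.Iio i).image σ := by
        rw [himg]
        exact Finset.mem_Iio.2 h1
      obtain ⟨s, hs, hsi⟩ := Finset.mem_image.1 this
      have := σ.injective hsi
      exact absurd (Finset.mem_Iio.1 hs) (by simp [this])
    · exact h1
  have vanish : ∀ C : Matrix (Fin N) (Fin N) R,
      (∀ i, bad i → ∀ r c, i ≤ r → c ≤ i → c < r → C r c = 0) → ∀ σ : Equiv.Perm (Fin N),
      (∃ i, bad i ∧ σ i ≠ i) → ∏ i, C (σ i) i = 0 := by
    rintro C hC σ ⟨i, hi, hne⟩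
    by_contra hprod
    refine hne (fixes σ i fun s h1 h2 h3 => hprod ?_)
    exact Finset.prod_eq_zero (Finset.mem_univ s) (hC i hi _ _ h1 h2 h3)
  rw [Matrix.det_apply, Matrix.det_apply]
  refine Finset.sum_congr rfl fun σ _ => ?_
  by_cases h : ∃ i, bad i ∧ σ i ≠ i
  · rw [vanish A hAl σ h, vanish B hBl σ h]
  · push Not at h
    congr 1
    refine Finset.prod_congr rfl fun i _ => ?_
    by_cases hi : bad i
    · rw [h i hi, hA1 i hi, hB1 i hi]
    -- All bad indices are fixed by `σ`, so a good column cannot be sent to a bad row.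
    · refine hAB _ _ (fun hb => hi ?_) hi
      have := σ.injective (h _ hb)
      rwa [this] at hb

/-- Jacobi's complementary minor theorem for a block decomposition. -/
theorem det_mul_det_toBlocks₁₁ {m n : Type*} [Fintype m] [Fintype n] [DecidableEq m]
    [DecidableEq n] (A B : Matrix (m ⊕ n) (m ⊕ n) R) (h : A * B = 1) :
    A.det * B.toBlocks₁₁.det = A.toBlocks₂₂.det := by
  -- Replacing the second block column of `B` by that of the identity makes both factors'
  -- determinants visible.
  have hblock : A * Matrix.fromBlocks B.toBlocks₁₁ 0 B.toBlocks₂₁ 1 =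
      Matrix.fromBlocks 1 A.toBlocks₁₂ 0 A.toBlocks₂₂ := by
    rw [← Matrix.fromBlocks_toBlocks A, ← Matrix.fromBlocks_toBlocks B,
      Matrix.fromBlocks_multiply, ← Matrix.fromBlocks_one, Matrix.fromBlocks_inj] at h
    conv_lhs => rw [← Matrix.fromBlocks_toBlocks A, Matrix.fromBlocks_multiply]
    rw [h.1, h.2.2.1]
    simp
  have := congrArg Matrix.det hblock
  rwa [Matrix.det_mul, Matrix.det_fromBlocks_zero₁₂, Matrix.det_fromBlocks_zero₂₁,
    Matrix.det_one, Matrix.det_one, mul_one, one_mul] at this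

/-- Jacobi's complementary minor theorem for a matrix of determinant `1`, with rows and columns
split by two bijections. -/
theorem sign_mul_det_inverse_minor {m n l : Type*} [Fintype m] [Fintype n] [Fintype l]
    [DecidableEq m] [DecidableEq n] [DecidableEq l] (e f : m ⊕ n ≃ l) (U T : Matrix l l R)
    (h : U * T = 1) (hU : U.det = 1) :
    ((Equiv.Perm.sign (e.trans f.symm) : ℤ) : R) *
        (T.submatrix (f ∘ Sum.inl) (e ∘ Sum.inl)).det =
      (U.submatrix (e ∘ Sum.inr) (f ∘ Sum.inr)).det := by
  have key := det_mul_det_toBlocks₁₁ (U.submatrix e f) (T.submatrix f e)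
    (by rw [Matrix.submatrix_mul_equiv, h, Matrix.submatrix_one_equiv])
  -- Rows and columns are renumbered differently, which costs the sign of the discrepancy.
  have hdet : (U.submatrix e f).det = ((Equiv.Perm.sign (e.trans f.symm) : ℤ) : R) := by
    have : U.submatrix e f = (U.submatrix f f).submatrix (e.trans f.symm) id := by
      ext i j
      simp
    rw [this, Matrix.det_permute, Matrix.det_submatrix_equiv_self, hU, mul_one]
  rw [hdet] at key
  exact key

/-- The entries of the inverse of an upper unitriangular matrix, as signed minors. -/
theorem unitriangular_inverse_apply {L : ℕ} (U T : Matrix (Fin L) (Fin L) R)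
    (hU0 : ∀ a b, b < a → U a b = 0) (hU1 : ∀ a, U a a = 1) (hT0 : ∀ a b, b < a → T a b = 0)
    (h : U * T = 1) (a k : ℕ) (hk : a + k < L) :
    T ⟨a, by omega⟩ ⟨a + k, hk⟩ = (-1) ^ k *
      (Matrix.of fun p q : Fin k => U ⟨a + p, by omega⟩ ⟨a + q + 1, by omega⟩).det := by
  let ι : Fin (k + 1) → Fin L := fun p => ⟨a + p, by omega⟩
  have hι : Function.Injective ι := by
    intro p q hpq
    have := congrArg Fin.val hpq
    simp only [ι] at this
    ext
    omega
  set V := U.submatrix ι ι with hV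
  set W := T.submatrix ι ι with hW
  -- Triangularity confines the summation index to the interval between row and column, so the
  -- windows of `U` and `T` are still inverse.
  have hVW : V * W = 1 := by
    ext p q
    have h1 := congrFun (congrFun h (ι p)) (ι q)
    rw [Matrix.mul_apply] at h1
    rw [Matrix.mul_apply]
    have h2 : ∑ s, V p s * W s q = ∑ r, U (ι p) r * T r (ι q) := by
      refine Fintype.sum_of_injective ι hι _ _ (fun r hr => ?_) fun s => rfl
      by_cases h3 : r < ι p
      · rw [hU0 _ _ h3, zero_mul]
      by_cases h4 : ι q < r
      · rw [hT0 _ _ h4, mul_zero]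
      · refine absurd ?_ hr
        have h5 : a + p.1 ≤ r.1 := not_lt.1 h3
        have h6 : r.1 ≤ a + q.1 := not_lt.1 h4
        exact ⟨⟨r.1 - a, by omega⟩, Fin.ext (by simp only [ι]; omega)⟩
    rw [h2, h1, Matrix.one_apply, Matrix.one_apply]
    simp [hι.eq_iff]
  have hdet : V.det = 1 := by
    rw [Matrix.det_of_isUpperTriangular]
    · exact Finset.prod_eq_one fun i _ => hU1 _
    · intro i j hij
      refine hU0 _ _ ?_
      have : j.1 < i.1 := hij
      exact Fin.mk_lt_mk.2 (by omega)
  have hadj : V.adjugate = W := by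
    calc V.adjugate = V.adjugate * (V * W) := by rw [hVW, mul_one]
      _ = W := by rw [← mul_assoc, Matrix.adjugate_mul, hdet, one_smul, one_mul]
  have h0 : T ⟨a, by omega⟩ ⟨a + k, hk⟩ = W 0 (Fin.last k) := rfl
  -- The corner cofactor deletes the last row and the first column of the window, hence the shift by
  -- one in the columns.
  rw [h0, ← hadj, Matrix.adjugate_fin_succ_eq_det_submatrix]
  congr 2
  ext p q
  simp [hV, ι, add_assoc]

end Matrices

/-! ### Boundary paths of diagrams and the signs of their numberings. -/

section Maya

/-- The vertical and horizontal boundary steps of a Young diagram with at most `n` rows and at most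
`N` columns, numbered along the boundary path. -/
def boundaryStep (lam : YoungDiagram) (n N : ℕ) (hN : lam.rowLen 0 ≤ N) :
    Fin n ⊕ Fin N → Fin (n + N)
  | Sum.inl p => ⟨lam.rowLen p + (n - 1 - p), by
      have := lam.rowLen_anti 0 p (Nat.zero_le _)
      omega⟩
  | Sum.inr q => ⟨q + n - lam.colLen q, by omega⟩

theorem lt_rowLen_iff_lt_colLen (lam : YoungDiagram) (p q : ℕ) :
    q < lam.rowLen p ↔ p < lam.colLen q := by
  rw [← YoungDiagram.mem_iff_lt_rowLen, ← YoungDiagram.mem_iff_lt_colLen]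

/-- A position counts the steps before it on the path from bottom left to top right: `λ_p`
horizontal and `n - 1 - p` vertical ones before row `p`, `q` horizontal and `n - λ'_q` vertical ones
before column `q` (indices from `0`). Which of row `p` and column `q` comes first depends on whether
the cell `(p, q)` is in the diagram. -/
theorem boundaryStep_injective (lam : YoungDiagram) (n N : ℕ) (hN : lam.rowLen 0 ≤ N)
    (hn : lam.colLen 0 ≤ n) : Function.Injective (boundaryStep lam n N hN) := by
  have mixed : ∀ (p : Fin n) (q : Fin N),
      lam.rowLen p + (n - 1 - p) ≠ q + n - lam.colLen q := by
    intro p q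
    have h1 := lt_rowLen_iff_lt_colLen lam p q
    have h2 := lam.colLen_anti 0 q (Nat.zero_le _)
    by_cases h : (q : ℕ) < lam.rowLen p
    · have := h1.1 h
      omega
    · have := mt h1.2 h
      omega
  rintro (p | q) (p' | q') h <;> have h := congrArg Fin.val h <;> simp only [boundaryStep] at h
  · have h1 := lam.rowLen_anti p p'
    have h2 := lam.rowLen_anti p' p
    congr 1
    ext
    omega
  · exact absurd h (mixed p q')
  · exact absurd h.symm (mixed p' q)
  · have h1 := lam.colLen_anti q q'
    have h2 := lam.colLen_anti q' q
    have h3 := lam.colLen_anti 0 q (Nat.zero_le _)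
    have h4 := lam.colLen_anti 0 q' (Nat.zero_le _)
    congr 1
    ext
    omega

/-- The numbering of the boundary steps of a Young diagram, as a bijection. -/
noncomputable def boundaryEquiv (lam : YoungDiagram) (n N : ℕ) (hN : lam.rowLen 0 ≤ N)
    (hn : lam.colLen 0 ≤ n) : Fin n ⊕ Fin N ≃ Fin (n + N) :=
  Equiv.ofBijective (boundaryStep lam n N hN)
    ((Fintype.bijective_iff_injective_and_card _).2
      ⟨boundaryStep_injective lam n N hN hn, by simp⟩)

theorem boundaryEquiv_inl (lam : YoungDiagram) (n N : ℕ) (hN : lam.rowLen 0 ≤ N)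
    (hn : lam.colLen 0 ≤ n) (p : Fin n) :
    (boundaryEquiv lam n N hN hn (Sum.inl p) : ℕ) = lam.rowLen p + (n - 1 - p) := rfl

theorem boundaryEquiv_inr (lam : YoungDiagram) (n N : ℕ) (hN : lam.rowLen 0 ≤ N)
    (hn : lam.colLen 0 ≤ n) (q : Fin N) :
    (boundaryEquiv lam n N hN hn (Sum.inr q) : ℕ) = q + n - lam.colLen q := rfl

theorem boundaryEquiv_inl_lt_inr (lam : YoungDiagram) (n N : ℕ) (hN : lam.rowLen 0 ≤ N)
    (hn : lam.colLen 0 ≤ n) (p : Fin n) (q : Fin N) :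
    boundaryEquiv lam n N hN hn (Sum.inl p) < boundaryEquiv lam n N hN hn (Sum.inr q) ↔
      ¬ (q : ℕ) < lam.rowLen p := by
  rw [Fin.lt_def, boundaryEquiv_inl, boundaryEquiv_inr]
  have h1 := lt_rowLen_iff_lt_colLen lam p q
  have h2 := lam.colLen_anti 0 q (Nat.zero_le _)
  omega

theorem boundaryEquiv_inl_lt_inl (lam : YoungDiagram) (n N : ℕ) (hN : lam.rowLen 0 ≤ N)
    (hn : lam.colLen 0 ≤ n) (p q : Fin n) :
    boundaryEquiv lam n N hN hn (Sum.inl p) < boundaryEquiv lam n N hN hn (Sum.inl q) ↔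
      q < p := by
  rw [Fin.lt_def, boundaryEquiv_inl, boundaryEquiv_inl, Fin.lt_def]
  have h1 := lam.rowLen_anti p q
  have h2 := lam.rowLen_anti q p
  omega

theorem boundaryEquiv_inr_lt_inr (lam : YoungDiagram) (n N : ℕ) (hN : lam.rowLen 0 ≤ N)
    (hn : lam.colLen 0 ≤ n) (p q : Fin N) :
    boundaryEquiv lam n N hN hn (Sum.inr p) < boundaryEquiv lam n N hN hn (Sum.inr q) ↔
      p < q := by
  rw [Fin.lt_def, boundaryEquiv_inr, boundaryEquiv_inr, Fin.lt_def]
  have h1 := lam.colLen_anti p q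
  have h2 := lam.colLen_anti q p
  have h3 := lam.colLen_anti 0 q (Nat.zero_le _)
  have h4 := lam.colLen_anti 0 p (Nat.zero_le _)
  omega

theorem prod_ite_lt_rowLen (lam : YoungDiagram) (N : ℕ) (hN : lam.rowLen 0 ≤ N) (p : ℕ) :
    ∏ q : Fin N, (if ¬ (q : ℕ) < lam.rowLen p then (1 : ℤˣ) else -1) = (-1) ^ lam.rowLen p := by
  have hp := (lam.rowLen_anti 0 p (Nat.zero_le _)).trans hN
  rw [Fin.prod_univ_eq_prod_range
    (fun q => if ¬ q < lam.rowLen p then (1 : ℤˣ) else -1) N]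
  simp only [ite_not]
  rw [Finset.prod_ite, Finset.prod_const, Finset.prod_const_one, mul_one]
  congr 1
  rw [show (Finset.range N).filter (· < lam.rowLen p) = Finset.range (lam.rowLen p) by
    ext q
    simp only [Finset.mem_filter, Finset.mem_range]
    omega, Finset.card_range]

/-- Up to a factor that does not depend on the diagram, the sign of the numbering of the boundary
steps is `(-1)^|λ|`. -/
theorem sign_boundaryEquiv (n N : ℕ) : ∃ C : ℤˣ, ∀ (lam : YoungDiagram)
    (hN : lam.rowLen 0 ≤ N) (hn : lam.colLen 0 ≤ n),
    Equiv.Perm.sign (finSumFinEquiv.symm.trans (boundaryEquiv lam n N hN hn)) =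
      C * ∏ p : Fin n, (-1) ^ lam.rowLen p := by
  refine ⟨(∏ q : Fin n, ∏ p : Fin n, if p < q then (-1) else 1), fun lam hN hn => ?_⟩
  have hIio : ∀ (σ : Equiv.Perm (Fin (n + N))) (j : Fin (n + N)),
      ∏ i ∈ Finset.Iio j, (if σ i < σ j then (1 : ℤˣ) else -1) =
        ∏ i, if i < j then (if σ i < σ j then 1 else -1) else 1 := by
    intro σ j
    rw [← Finset.prod_filter]
    congr 1
    ext i
    simp
  rw [Equiv.Perm.sign_eq_prod_prod_Iio]
  simp_rw [hIio]
  rw [Fin.prod_univ_add]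
  simp_rw [Fin.prod_univ_add]
  simp only [Equiv.trans_apply, finSumFinEquiv_symm_apply_castAdd,
    finSumFinEquiv_symm_apply_natAdd, boundaryEquiv_inl_lt_inr, boundaryEquiv_inl_lt_inl,
    boundaryEquiv_inr_lt_inr, Finset.prod_mul_distrib]
  -- Inversions are counted against the order "all rows, then all columns". Column-row pairs do not
  -- occur, and columns keep their order.
  have e1 : ∏ q : Fin n, ∏ p : Fin N,
      (if Fin.natAdd n p < Fin.castAdd N q then
        (if boundaryEquiv lam n N hN hn (Sum.inr p) < boundaryEquiv lam n N hN hn (Sum.inl q)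
          then (1 : ℤˣ) else -1) else 1) = 1 := by
    refine Finset.prod_eq_one fun q _ => Finset.prod_eq_one fun p _ => if_neg ?_
    simp only [Fin.lt_def, Fin.val_natAdd, Fin.val_castAdd]
    omega
  have e2 : ∏ q : Fin N, ∏ p : Fin N,
      (if Fin.natAdd n p < Fin.natAdd n q then (if p < q then (1 : ℤˣ) else -1) else 1) = 1 := by
    refine Finset.prod_eq_one fun q _ => Finset.prod_eq_one fun p _ => ?_
    split_ifs with h1 h2 <;> simp_all
  -- A row and a column are inverted exactly when they meet in a cell of the diagram.
  have e3 : ∏ q : Fin N, ∏ p : Fin n,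
      (if Fin.castAdd N p < Fin.natAdd n q then
        (if ¬ (q : ℕ) < lam.rowLen p then (1 : ℤˣ) else -1) else 1) =
      ∏ p : Fin n, (-1) ^ lam.rowLen p := by
    rw [Finset.prod_comm]
    refine Finset.prod_congr rfl fun p _ => ?_
    rw [← prod_ite_lt_rowLen lam N hN p]
    refine Finset.prod_congr rfl fun q _ => if_pos ?_
    simp only [Fin.lt_def, Fin.val_natAdd, Fin.val_castAdd]
    omega
  -- Any two rows are inverted, since the path meets the lower row first; this is the constant `C`.
  have e4 : ∏ q : Fin n, ∏ p : Fin n,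
      (if Fin.castAdd N p < Fin.castAdd N q then (if q < p then (1 : ℤˣ) else -1) else 1) =
      ∏ q : Fin n, ∏ p : Fin n, if p < q then (-1) else 1 := by
    refine Finset.prod_congr rfl fun q _ => Finset.prod_congr rfl fun p _ => ?_
    simp only [Fin.lt_def, Fin.val_castAdd]
    split_ifs <;> first | rfl | omega
  rw [e1, e2, e3, e4, mul_one, mul_one]

/-- Conjugation turns the permutation into a quotient of the two numberings of `Fin (n + N)`, in
which the common constant squares to `1`. -/
theorem sign_boundaryEquiv_trans_symm (lam mu : YoungDiagram) (n N : ℕ) (hN : lam.rowLen 0 ≤ N)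
    (hn : lam.colLen 0 ≤ n) (hN' : mu.rowLen 0 ≤ N) (hn' : mu.colLen 0 ≤ n) :
    Equiv.Perm.sign ((boundaryEquiv lam n N hN hn).trans (boundaryEquiv mu n N hN' hn').symm) =
      (∏ p : Fin n, (-1) ^ lam.rowLen p) * ∏ p : Fin n, (-1) ^ mu.rowLen p := by
  obtain ⟨C, hC⟩ := sign_boundaryEquiv n N
  set e := boundaryEquiv lam n N hN hn
  set f := boundaryEquiv mu n N hN' hn'
  have h1 : Equiv.Perm.sign (e.trans f.symm) =
      Equiv.Perm.sign ((finSumFinEquiv.symm.trans f).symm.trans (finSumFinEquiv.symm.trans e)) := by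
    rw [← Equiv.Perm.sign_symm_trans_trans (e.trans f.symm) f]
    congr 1
    ext t
    simp
  have h2 : ((finSumFinEquiv.symm.trans f).symm.trans (finSumFinEquiv.symm.trans e) :
      Equiv.Perm (Fin (n + N))) =
      (finSumFinEquiv.symm.trans e : Equiv.Perm (Fin (n + N))) *
        (finSumFinEquiv.symm.trans f : Equiv.Perm (Fin (n + N)))⁻¹ := rfl
  rw [h1, h2, Equiv.Perm.sign_mul, Equiv.Perm.sign_inv, hC, hC]
  rw [mul_mul_mul_comm, Int.units_mul_self, one_mul]

end Maya

/-! ### The matrix indexed by contents and its minors. -/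

section ContentMatrix

theorem conj_oneRow {k p : ℕ} (hp : p < k) : conj (oneRow k) (p + 1) = 1 := by
  have hmem : ∀ i, i < (oneRow k).colLen p ↔ i < 1 := by
    intro i
    rw [← YoungDiagram.mem_iff_lt_colLen, oneRow, YoungDiagram.mem_ofRowLens]
    constructor
    · rintro ⟨h, -⟩
      simpa using h
    · intro h
      obtain rfl : i = 0 := by omega
      exact ⟨by simp, by simpa using hp⟩
  have h1 := hmem 0
  have h2 := hmem 1
  simp only [conj, Nat.add_sub_cancel]
  omega

theorem conj_bot (j : ℕ) : conj ⊥ j = 0 := by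
  by_contra h
  exact YoungDiagram.notMem_bot _
    (YoungDiagram.mem_iff_lt_colLen.2 (Nat.pos_of_ne_zero h))

variable {R : Type*} [CommRing R]

/-- The entry indexed by contents `d, d'` of the infinite matrix whose contiguous principal minors
are the functions `h` of the rows with flags `A`, `B`. -/
noncomputable def contentEntry (y z : ℤ → R) (A B : ℤ → ℤ) (d d' : ℤ) : R :=
  eSuper (interval y (A d') (B d)) (interval z (A d' + d') (B d + d)) (1 + d' - d)

theorem eSuper_interval_congr (y z : ℤ → R) {a a' b b' c c' d d' k k' : ℤ} (ha : a = a')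
    (hb : b = b') (hc : c = c') (hd : d = d') (hk : k = k') :
    eSuper (interval y a b) (interval z c d) k = eSuper (interval y a' b') (interval z c' d') k' := by
  subst ha hb hc hd hk
  rfl

/-- Only the content `c + r - 1` matters, so one function of the content serves all entries of the
Jacobi–Trudi matrix. -/
theorem inducedA_eq (lam mu : YoungDiagram) (a : ℕ → ℤ) (c : ℤ) (r : ℕ) :
    inducedA lam mu a c r = inducedA lam mu a (c + r - 1) 1 := by
  have h : c + r - 1 = c + r - 1 + ((1 : ℕ) : ℤ) - 1 := by push_cast; ring
  unfold inducedA
  rw [← h]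

theorem inducedB_eq (lam mu : YoungDiagram) (b : ℕ → ℤ) (c : ℤ) (r : ℕ) :
    inducedB lam mu b c r = inducedB lam mu b (c + r - 1) 1 := by
  have h : c + r - 1 = c + r - 1 + ((1 : ℕ) : ℤ) - 1 := by push_cast; ring
  unfold inducedB
  rw [← h]

theorem hFlag_of_neg {k : ℤ} (hk : k < 0) (c : ℤ) (a b : ℕ → ℤ) (m : ℕ) (x α β : ℕ → R) :
    hFlag k c a b m x α β = 0 :=
  if_pos hk

/-- In a single row each cell is both top and bottom of its column, so both conjugate flags are
shifts by the cell's own content. -/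
theorem hFlag_natCast (k : ℕ) (c : ℤ) (a b : ℕ → ℤ) (A B : ℤ → ℤ)
    (ha : ∀ r, a r = A (c + r - 1)) (hb : ∀ r, b r = B (c + r - 1)) (m : ℕ) (x α β : ℕ → R) :
    hFlag k c a b m x α β = (Matrix.of fun p q : Fin k =>
      contentEntry (gY m x α β) (gZ m α β) A B (c + p) (c + q)).det := by
  rw [hFlag, if_neg (by omega), flaggedDualGroth, flaggedSchur, Int.toNat_natCast]
  congr 1
  ext p q
  have h0 : conj (oneRow k) 1 = 1 := conj_oneRow (p := 0) (by have := p.2; omega)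
  have hp := conj_oneRow p.2
  have hq : c + ((q + 1 : ℕ) : ℤ) - 1 = c + q := by push_cast; ring
  have hp' : c + ((p + 1 : ℕ) : ℤ) - 1 = c + p := by push_cast; ring
  simp only [Matrix.of_apply, contentEntry]
  refine eSuper_interval_congr _ _ ?_ ?_ ?_ ?_ ?_
  · rw [ha, hq]
  · rw [hb, hp']
  · rw [conjFlagA, rContent, h0, ha, hq, conj_bot]
    push_cast
    ring
  · rw [conjFlagB, rContent, h0, hb, hp', hp]
    push_cast
    ring
  · rw [hp, conj_bot]
    push_cast
    ring

/-- A cell further left on the diagonal of a column's top cell lies in a higher row, hence in `μ`;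
the top cell is thus leftmost and the row correction cancels. -/
theorem inducedA_top (lam mu : YoungDiagram) (a : ℕ → ℤ) (q : ℕ)
    (h : mu.colLen q < lam.colLen q) :
    inducedA lam mu a (q - mu.colLen q) 1 = a (q + 1) := by
  have hd : (q : ℤ) - mu.colLen q + (1 : ℕ) - 1 = q - mu.colLen q := by push_cast; ring
  have hmem : q + 1 ∈ contentCols lam mu (q - mu.colLen q) := by
    refine Finset.mem_image.2 ⟨(mu.colLen q, q), Finset.mem_filter.2 ⟨?_, rfl⟩, rfl⟩
    rw [Finset.mem_sdiff, YoungDiagram.mem_cells, YoungDiagram.mem_cells,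
      YoungDiagram.mem_iff_lt_colLen, YoungDiagram.mem_iff_lt_colLen]
    omega
  have hmin : (contentCols lam mu (q - mu.colLen q)).min' ⟨_, hmem⟩ = q + 1 := by
    refine le_antisymm (Finset.min'_le _ _ hmem) (Finset.le_min' _ _ _ fun s hs => ?_)
    obtain ⟨⟨r, s⟩, hrs, rfl⟩ := Finset.mem_image.1 hs
    obtain ⟨hrs, hc⟩ := Finset.mem_filter.1 hrs
    rw [Finset.mem_sdiff, YoungDiagram.mem_cells, YoungDiagram.mem_cells,
      YoungDiagram.mem_iff_lt_colLen, YoungDiagram.mem_iff_lt_colLen] at hrs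
    simp only at hc hrs ⊢
    by_contra hlt
    have := mu.colLen_anti s q (by omega)
    omega
  simp only [inducedA, hd]
  rw [dif_pos ⟨_, hmem⟩, hmin]
  simp only [conj, Nat.add_sub_cancel]
  push_cast
  ring

/-- A cell further right on the diagonal of a column's bottom cell lies in a lower row, hence
outside `λ`. -/
theorem inducedB_bottom (lam mu : YoungDiagram) (b : ℕ → ℤ) (q : ℕ)
    (h : mu.colLen q < lam.colLen q) :
    inducedB lam mu b (q + 1 - lam.colLen q) 1 = b (q + 1) := by
  have hd : (q : ℤ) + 1 - lam.colLen q + (1 : ℕ) - 1 = q + 1 - lam.colLen q := by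
    push_cast; ring
  have hmem : q + 1 ∈ contentCols lam mu (q + 1 - lam.colLen q) := by
    refine Finset.mem_image.2 ⟨(lam.colLen q - 1, q), Finset.mem_filter.2 ⟨?_, ?_⟩, rfl⟩
    · rw [Finset.mem_sdiff, YoungDiagram.mem_cells, YoungDiagram.mem_cells,
        YoungDiagram.mem_iff_lt_colLen, YoungDiagram.mem_iff_lt_colLen]
      omega
    · simp only
      omega
  have hmax : (contentCols lam mu (q + 1 - lam.colLen q)).max' ⟨_, hmem⟩ = q + 1 := by
    refine le_antisymm (Finset.max'_le _ _ _ fun s hs => ?_) (Finset.le_max' _ _ hmem)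
    obtain ⟨⟨r, s⟩, hrs, rfl⟩ := Finset.mem_image.1 hs
    obtain ⟨hrs, hc⟩ := Finset.mem_filter.1 hrs
    rw [Finset.mem_sdiff, YoungDiagram.mem_cells, YoungDiagram.mem_cells,
      YoungDiagram.mem_iff_lt_colLen, YoungDiagram.mem_iff_lt_colLen] at hrs
    simp only at hc hrs ⊢
    by_contra hlt
    have := lam.colLen_anti q s (by omega)
    omega
  simp only [inducedB, hd]
  rw [dif_pos ⟨_, hmem⟩, hmax]
  simp only [conj, Nat.add_sub_cancel]
  push_cast
  ring

/-- The finite window of the matrix of contents that is relevant for diagrams with at most `n` rows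
and at most `N` columns. -/
noncomputable def windowMatrix (n N : ℕ) (y z : ℤ → R) (A B : ℤ → ℤ) :
    Matrix (Fin (n + N)) (Fin (n + N)) R :=
  Matrix.of fun a b => contentEntry y z A B ((a : ℕ) + 1 - n) ((b : ℕ) - n)

section Window

variable (n N : ℕ) (y z : ℤ → R) (A B : ℤ → ℤ)

theorem windowMatrix_of_lt (a b : Fin (n + N)) (h : b < a) : windowMatrix n N y z A B a b = 0 :=
  eSuper_of_neg _ _ (by have : (b : ℕ) < a := h; omega)

theorem windowMatrix_self (a : Fin (n + N)) : windowMatrix n N y z A B a a = 1 := by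
  have h : (1 : ℤ) + ((a : ℕ) - n) - ((a : ℕ) + 1 - n) = 0 := by ring
  simp only [windowMatrix, Matrix.of_apply, contentEntry]
  rw [h, eSuper_zero]

theorem windowMatrix_isUpperTriangular : (windowMatrix n N y z A B).BlockTriangular id :=
  fun a b h => windowMatrix_of_lt n N y z A B a b h

theorem det_windowMatrix : (windowMatrix n N y z A B).det = 1 := by
  rw [Matrix.det_of_isUpperTriangular (windowMatrix_isUpperTriangular n N y z A B)]
  exact Finset.prod_eq_one fun a _ => windowMatrix_self n N y z A B a

theorem windowMatrix_mul_inv : windowMatrix n N y z A B * (windowMatrix n N y z A B)⁻¹ = 1 :=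
  Matrix.mul_nonsing_inv _ (by rw [det_windowMatrix]; exact isUnit_one)

theorem inv_windowMatrix_of_lt (a b : Fin (n + N)) (h : b < a) :
    (windowMatrix n N y z A B)⁻¹ a b = 0 := by
  have := Matrix.invertibleOfIsUnitDet (windowMatrix n N y z A B)
    (by rw [det_windowMatrix]; exact isUnit_one)
  exact Matrix.blockTriangular_inv_of_blockTriangular
    (windowMatrix_isUpperTriangular n N y z A B) h

end Window

/-! ### Both sides of the formula as one minor of the window. -/

variable (m : ℕ) (x α β : ℕ → R)

/-- The cofactor sign `(-1)^(t-s)` is split into a row and a column factor so that both can be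
pulled out of a determinant. For `t < s` both sides vanish. -/
theorem inv_windowMatrix_apply (n N : ℕ) (A B : ℤ → ℤ) (s t : Fin (n + N)) (k c : ℤ)
    (hk : k = (t : ℕ) - (s : ℕ)) (hc : c = (s : ℕ) + 1 - n) (a b : ℕ → ℤ)
    (ha : ∀ r, a r = A (c + r - 1)) (hb : ∀ r, b r = B (c + r - 1)) :
    (windowMatrix n N (gY m x α β) (gZ m α β) A B)⁻¹ s t =
      (-1) ^ (s : ℕ) * ((-1) ^ (t : ℕ) * hFlag k c a b m x α β) := by
  rcases lt_or_ge t s with h | h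
  · have : (t : ℕ) < s := h
    rw [inv_windowMatrix_of_lt _ _ _ _ _ _ _ _ h, hFlag_of_neg (by omega), mul_zero, mul_zero]
  · obtain ⟨s, hs⟩ := s
    obtain ⟨t, ht⟩ := t
    obtain ⟨l, rfl⟩ := Nat.exists_eq_add_of_le (show s ≤ t from h)
    obtain rfl : k = l := by
      simp only at hk
      omega
    simp only at hc
    rw [unitriangular_inverse_apply _ _ (windowMatrix_of_lt n N _ _ A B)
      (windowMatrix_self n N _ _ A B) (inv_windowMatrix_of_lt n N _ _ A B)
      (windowMatrix_mul_inv n N _ _ A B) s l ht,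
      hFlag_natCast l c a b A B ha hb, ← mul_assoc, ← pow_add]
    congr 1
    · rw [show s + (s + l) = 2 * s + l by ring, pow_add, pow_mul]
      simp
    · congr 1
      ext p q
      simp only [windowMatrix, Matrix.of_apply]
      congr 1 <;> (push_cast; omega)

theorem det_jacobiTrudi (n N : ℕ) (lam mu : YoungDiagram) (hN : lam.rowLen 0 ≤ N)
    (hn : lam.colLen 0 ≤ n) (hN' : mu.rowLen 0 ≤ N) (hn' : mu.colLen 0 ≤ n) :
    (jacobiTrudi n lam mu m x α β).det =
      ((windowMatrix n N (gY m x α β) (gZ m α β) (fun d => inducedA lam mu flagA d 1)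
          (fun d => inducedB lam mu (flagB lam m) d 1)).submatrix
        (boundaryEquiv lam n N hN hn ∘ Sum.inr) (boundaryEquiv mu n N hN' hn' ∘ Sum.inr)).det := by
  rw [← sign_mul_det_inverse_minor _ _ _ _ (windowMatrix_mul_inv n N _ _ _ _)
    (det_windowMatrix n N _ _ _ _), sign_boundaryEquiv_trans_symm]
  set e := boundaryEquiv lam n N hN hn
  set f := boundaryEquiv mu n N hN' hn'
  have hT : (windowMatrix n N (gY m x α β) (gZ m α β) (fun d => inducedA lam mu flagA d 1)
      (fun d => inducedB lam mu (flagB lam m) d 1))⁻¹.submatrix (f ∘ Sum.inl) (e ∘ Sum.inl) =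
      Matrix.of fun q p => (-1) ^ (f (Sum.inl q) : ℕ) *
        (Matrix.of fun q p => (-1) ^ (e (Sum.inl p) : ℕ) *
          (jacobiTrudi n lam mu m x α β).transpose q p) q p := by
    ext q p
    simp only [Matrix.submatrix_apply, Function.comp_apply, Matrix.of_apply,
      Matrix.transpose_apply, jacobiTrudi]
    refine inv_windowMatrix_apply m x α β n N _ _ _ _ _ _ ?_ ?_ _ _
      (fun r => inducedA_eq _ _ _ _ _) (fun r => inducedB_eq _ _ _ _ _)
    · rw [boundaryEquiv_inl, boundaryEquiv_inl]
      simp only [part, Nat.add_sub_cancel]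
      have := p.2
      have := q.2
      omega
    · rw [boundaryEquiv_inl]
      simp only [part, Nat.add_sub_cancel]
      have := q.2
      omega
  rw [hT, Matrix.det_mul_column, Matrix.det_mul_row, Matrix.det_transpose]
  -- For each `p` the exponents add up to twice `λ_p + μ_p + (n - 1 - p)`.
  have hsign : (((∏ p : Fin n, (-1) ^ lam.rowLen p) * ∏ p : Fin n, (-1) ^ mu.rowLen p : ℤˣ) : ℤ) *
      ((∏ q, (-1) ^ (f (Sum.inl q) : ℕ)) * ∏ p, (-1) ^ (e (Sum.inl p) : ℕ)) = 1 := by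
    push_cast
    rw [← Finset.prod_mul_distrib, ← Finset.prod_mul_distrib, ← Finset.prod_mul_distrib]
    refine Finset.prod_eq_one fun p _ => ?_
    rw [boundaryEquiv_inl, boundaryEquiv_inl, ← pow_add, ← pow_add, ← pow_add]
    exact Even.neg_one_pow ⟨lam.rowLen p + mu.rowLen p + (n - 1 - p), by ring⟩
  have hsign := congrArg (Int.cast : ℤ → R) hsign
  push_cast at hsign ⊢
  rw [← mul_assoc, ← mul_assoc, mul_assoc _ _ (∏ p, (-1) ^ (e (Sum.inl p) : ℕ)), hsign, one_mul]

theorem dualGroth_eq_minor (n N : ℕ) (lam mu : YoungDiagram) (hle : mu ≤ lam)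
    (hN : lam.rowLen 0 ≤ N)
    (hn : lam.colLen 0 ≤ n) (hN' : mu.rowLen 0 ≤ N) (hn' : mu.colLen 0 ≤ n) :
    dualGroth N lam mu m x α β =
      ((windowMatrix n N (gY m x α β) (gZ m α β) (fun d => inducedA lam mu flagA d 1)
          (fun d => inducedB lam mu (flagB lam m) d 1)).submatrix
        (boundaryEquiv lam n N hN hn ∘ Sum.inr) (boundaryEquiv mu n N hN' hn' ∘ Sum.inr)).det := by
  have hcol : ∀ q, mu.colLen q ≤ lam.colLen q := by
    intro q
    by_contra h
    push Not at h
    have := hle (YoungDiagram.mem_iff_lt_colLen.2 h)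
    exact absurd (YoungDiagram.mem_iff_lt_colLen.1 this) (lt_irrefl _)
  have hd : ∀ p : Fin N, ((boundaryEquiv lam n N hN hn (Sum.inr p) : ℕ) : ℤ) + 1 - n =
      (p : ℕ) + 1 - lam.colLen p := by
    intro p
    have := lam.colLen_anti 0 p (Nat.zero_le _)
    rw [boundaryEquiv_inr]
    omega
  have hd' : ∀ q : Fin N, ((boundaryEquiv mu n N hN' hn' (Sum.inr q) : ℕ) : ℤ) - n =
      (q : ℕ) - mu.colLen q := by
    intro q
    have := mu.colLen_anti 0 q (Nat.zero_le _)
    rw [boundaryEquiv_inr]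
    omega
  -- At an empty column, `λ'_r ≤ λ'_i = μ'_i ≤ μ'_c`, and `c < r` makes the degree negative.
  have hneg : ∀ i, lam.colLen i = mu.colLen i → ∀ r c, i ≤ r → c ≤ i → c < r →
      (lam.colLen r : ℤ) - r - mu.colLen c + c < 0 := by
    intro i hi r c h1 h2 h3
    have h4 := lam.colLen_anti i r h1
    have h5 := mu.colLen_anti c i h2
    omega
  rw [dualGroth]
  refine det_eq_of_split _ _ (fun i => lam.colLen i = mu.colLen i) ?_ ?_ ?_ ?_ ?_
  · intro i hi r c h1 h2 h3
    have := hneg i hi r c h1 h2 h3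
    refine eSuper_of_neg _ _ ?_
    simp only [conj, Nat.add_sub_cancel]
    omega
  · intro i hi r c h1 h2 h3
    have := hneg i hi r c h1 h2 h3
    simp only [Matrix.submatrix_apply, Function.comp_apply, windowMatrix, Matrix.of_apply, hd, hd']
    refine eSuper_of_neg _ _ ?_
    omega
  · intro i hi
    simp only [Matrix.of_apply, conj, Nat.add_sub_cancel]
    rw [show ((lam.colLen i : ℤ) - (i + 1 : ℕ) - mu.colLen i + (i + 1 : ℕ)) = 0 by omega]
    exact eSuper_zero _ _
  · intro i hi
    simp only [Matrix.submatrix_apply, Function.comp_apply, windowMatrix, Matrix.of_apply, hd, hd',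
      contentEntry]
    rw [show (1 + ((i : ℕ) - (mu.colLen i : ℤ)) - ((i : ℕ) + 1 - lam.colLen i)) = 0 by omega]
    exact eSuper_zero _ _
  · intro i j hi hj
    -- Nonemptiness makes the flag lemmas applicable and keeps the natural subtraction in `conj lam
    -- i - 1` from truncating.
    have hi' := lt_of_le_of_ne (hcol i) (Ne.symm hi)
    have hj' := lt_of_le_of_ne (hcol j) (Ne.symm hj)
    simp only [Matrix.submatrix_apply, Function.comp_apply, windowMatrix, Matrix.of_apply, hd, hd',
      contentEntry]
    rw [eSuper_specialization]
    refine eSuper_interval_congr _ _ ?_ ?_ ?_ ?_ ?_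
    · rw [hd', inducedA_top _ _ _ _ hj', flagA]
      push_cast
      omega
    · rw [hd, inducedB_bottom _ _ _ _ hi', flagB]
      simp only [conj, Nat.add_sub_cancel]
      omega
    · rw [hd', inducedA_top _ _ _ _ hj', flagA]
      simp only [conj, Nat.add_sub_cancel]
      push_cast
      omega
    · rw [hd, inducedB_bottom _ _ _ _ hi', flagB]
      simp only [conj, Nat.add_sub_cancel]
      omega
    · simp only [conj, Nat.add_sub_cancel]
      push_cast
      omega

/-- The Jacobi–Trudi-type formula for dual refined canonical stable Grothendieck polynomials. -/
theorem dualGroth_eq_det_jacobiTrudi (n N : ℕ) (lam mu : YoungDiagram) (hle : mu ≤ lam)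
    (hN : part lam 1 ≤ N) (hn : conj lam 1 ≤ n) :
    dualGroth N lam mu m x α β = (jacobiTrudi n lam mu m x α β).det := by
  have hrow : mu.rowLen 0 ≤ lam.rowLen 0 := by
    by_contra h
    push Not at h
    have := hle (YoungDiagram.mem_iff_lt_rowLen.2 h)
    exact absurd (YoungDiagram.mem_iff_lt_rowLen.1 this) (lt_irrefl _)
  have hcol : mu.colLen 0 ≤ lam.colLen 0 := by
    by_contra h
    push Not at h
    have := hle (YoungDiagram.mem_iff_lt_colLen.2 h)
    exact absurd (YoungDiagram.mem_iff_lt_colLen.1 this) (lt_irrefl _)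
  rw [dualGroth_eq_minor m x α β n N lam mu hle hN hn (hrow.trans hN) (hcol.trans hn),
    det_jacobiTrudi m x α β n N lam mu hN hn (hrow.trans hN) (hcol.trans hn)]

end ContentMatrix

/-! ### The shape `(1,1)` separates the two Jacobi–Trudi matrices. -/

section Comparison

/-- The partition `(1, 1)`. -/
def columnTwo : YoungDiagram := YoungDiagram.ofRowLens [1, 1] (by decide)

theorem mem_columnTwo (i j : ℕ) : (i, j) ∈ columnTwo ↔ i < 2 ∧ j = 0 := by
  rw [columnTwo, YoungDiagram.mem_ofRowLens]
  constructor
  · rintro ⟨h, h'⟩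
    have h : i < 2 := by simpa using h
    interval_cases i <;> simpa using h'
  · rintro ⟨h, rfl⟩
    refine ⟨by simpa using h, ?_⟩
    interval_cases i <;> simp

theorem colLen_columnTwo : columnTwo.colLen 0 = 2 := by
  have h : ∀ i, i < columnTwo.colLen 0 ↔ i < 2 := fun i => by
    rw [← YoungDiagram.mem_iff_lt_colLen, mem_columnTwo]
    simp
  have h1 := h 1
  have h2 := h 2
  omega

theorem rowLen_columnTwo {i : ℕ} (hi : i < 2) : columnTwo.rowLen i = 1 := by
  have h : ∀ j, j < columnTwo.rowLen i ↔ j = 0 := fun j => by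
    rw [← YoungDiagram.mem_iff_lt_rowLen, mem_columnTwo]
    simp [hi]
  have h1 := h 0
  have h2 := h 1
  omega

theorem part_bot (i : ℕ) : part ⊥ i = 0 := by
  by_contra h
  exact YoungDiagram.notMem_bot _
    (YoungDiagram.mem_iff_lt_rowLen.2 (Nat.pos_of_ne_zero h))

theorem contentCols_columnTwo {c : ℤ} (h : c = -1 ∨ c = 0) :
    contentCols columnTwo ⊥ c = {1} := by
  ext s
  simp only [contentCols, Finset.mem_image, Finset.mem_filter, Finset.mem_sdiff,
    YoungDiagram.mem_cells, YoungDiagram.cells_bot, Finset.notMem_empty, not_false_eq_true,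
    and_true, Prod.exists, mem_columnTwo, Finset.mem_singleton]
  constructor
  · rintro ⟨i, j, ⟨⟨-, rfl⟩, -⟩, rfl⟩
    rfl
  · rintro rfl
    exact ⟨(-c).toNat, 0, ⟨⟨by omega, rfl⟩, by push_cast; omega⟩, rfl⟩

theorem inducedA_columnTwo {c : ℤ} (h : c = -1 ∨ c = 0) :
    inducedA columnTwo ⊥ flagA c 1 = 1 - c := by
  have hd : c + (1 : ℕ) - 1 = c := by push_cast; ring
  simp only [inducedA, hd, contentCols_columnTwo h, Finset.singleton_nonempty, dif_pos,
    Finset.min'_singleton, flagA, conj_bot]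
  push_cast
  ring

theorem inducedB_columnTwo {c : ℤ} (h : c = -1 ∨ c = 0) :
    inducedB columnTwo ⊥ (flagB columnTwo 1) c 1 = 1 - c := by
  have hd : c + (1 : ℕ) - 1 = c := by push_cast; ring
  have h2 : conj columnTwo 1 = 2 := colLen_columnTwo
  simp only [inducedB, hd, contentCols_columnTwo h, Finset.singleton_nonempty, dif_pos,
    Finset.max'_singleton, flagB, h2]
  push_cast
  ring

/-- With `Y = 0` only `e_k(X)` survives, and each of its monomials contains a zero variable. -/
theorem eSuper_eq_zero_of_card_lt {R : Type*} [CommRing R] {σ τ : Type*} [Fintype σ] [Fintype τ]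
    [DecidableEq τ] (X : σ → R) (Y : τ → R) (hY : ∀ t, Y t = 0) (k : ℕ)
    (hX : ∀ t ∈ Finset.powersetCard k (Finset.univ : Finset σ), ∃ i ∈ t, X i = 0) :
    eSuper X Y k = 0 := by
  rw [eSuper, if_neg (by omega), Int.toNat_natCast]
  refine Finset.sum_eq_zero fun i hi => ?_
  rcases Nat.lt_or_ge i k with h | h
  · rw [← aeval_hsymm_of_injective (τ := Empty) (fun e => e.elim) Y (fun e => e.elim)
      (fun e => e.elim) (fun e => e.elim) (fun t _ => hY t), aeval_hsymm]
    have : IsEmpty (Sym Empty (k - i)) := by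
      obtain ⟨l, hl⟩ : ∃ l, k - i = l + 1 := ⟨k - i - 1, by omega⟩
      rw [hl]
      infer_instance
    rw [Finset.univ_eq_empty, Finset.sum_empty, mul_zero]
  · obtain rfl : i = k := by have := Finset.mem_range.1 hi; omega
    rw [MvPolynomial.esymm, map_sum, Finset.sum_eq_zero, mul_zero, zero_mul]
    intro t ht
    obtain ⟨j, hj, hj0⟩ := hX t ht
    rw [map_prod]
    exact Finset.prod_eq_zero hj (by rw [MvPolynomial.aeval_X, hj0])

/-- The entry is a `2 × 2` determinant with first row `e_1(y_2 / z_1)`, `e_2(y_1, y_2 / z_1)`, and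
this row vanishes because `y_2 = β_1 = 0` and `z_1 = 0`. The size stays a variable so that the
result applies to `conj columnTwo 1`. -/
theorem jacobiTrudi_columnTwo (n : ℕ) (hn : 1 < n) :
    jacobiTrudi n columnTwo ⊥ 1 (fun _ => (1 : ℤ)) (fun _ => 0) (fun _ => 0)
      ⟨0, by omega⟩ ⟨1, hn⟩ = 0 := by
  have hk : (part columnTwo 1 : ℤ) - part ⊥ 2 - (1 : ℕ) + (2 : ℕ) = (2 : ℕ) := by
    rw [part_bot, show part columnTwo 1 = 1 from rowLen_columnTwo (by norm_num)]
    norm_num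
  have hc : (part ⊥ 2 : ℤ) + 1 - (2 : ℕ) = -1 := by
    rw [part_bot]
    norm_num
  change hFlag ((part columnTwo 1 : ℤ) - part ⊥ 2 - (1 : ℕ) + (2 : ℕ))
    ((part ⊥ 2 : ℤ) + 1 - (2 : ℕ)) (inducedA columnTwo ⊥ flagA ((part ⊥ 2 : ℤ) + 1 - (2 : ℕ)))
    (inducedB columnTwo ⊥ (flagB columnTwo 1) ((part ⊥ 2 : ℤ) + 1 - (2 : ℕ))) 1 _ _ _ = 0
  have hA1 := inducedA_columnTwo (c := -1) (Or.inl rfl)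
  have hA0 := inducedA_columnTwo (c := 0) (Or.inr rfl)
  have hB1 := inducedB_columnTwo (c := -1) (Or.inl rfl)
  have hz : ∀ t : Finset.Icc (1 : ℤ) 1, interval (gZ 1 (fun _ => (0 : ℤ)) fun _ => 0) 1 1 t = 0 :=
    fun t => gZ_mid _ _ _ (by have := Finset.mem_Icc.1 t.2; omega)
      (by have := Finset.mem_Icc.1 t.2; push_cast; omega)
  have hy : gY 1 (fun _ => (1 : ℤ)) (fun _ => 0) (fun _ => 0) 2 = 0 :=
    gY_right 1 _ _ (fun _ => 0) 0
  rw [hk, hc, hFlag_natCast 2 (-1) _ _ (fun d => inducedA columnTwo ⊥ flagA d 1)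
      (fun d => inducedB columnTwo ⊥ (flagB columnTwo 1) d 1) (inducedA_eq _ _ _ _)
      (inducedB_eq _ _ _ _),
    Matrix.det_fin_two]
  have h00 : contentEntry (gY 1 (fun _ => (1 : ℤ)) (fun _ => 0) (fun _ => 0))
      (gZ 1 (fun _ => 0) fun _ => 0) (fun d => inducedA columnTwo ⊥ flagA d 1)
      (fun d => inducedB columnTwo ⊥ (flagB columnTwo 1) d 1) (-1) (-1) = 0 := by
    rw [contentEntry, eSuper_interval_congr _ _ (a' := 2) (b' := 2) (c' := 1) (d' := 1)
      (k' := (1 : ℕ)) (by simp only [hA1]; norm_num) (by simp only [hB1]; norm_num)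
      (by simp only [hA1]; norm_num) (by simp only [hB1]; norm_num) (by norm_num)]
    refine eSuper_eq_zero_of_card_lt _ _ hz _ fun t ht => ?_
    obtain ⟨i, rfl⟩ := Finset.card_eq_one.1 (Finset.mem_powersetCard.1 ht).2
    refine ⟨i, Finset.mem_singleton_self i, ?_⟩
    have hi : (i : ℤ) = 2 := by have := Finset.mem_Icc.1 i.2; omega
    rw [interval, hi, hy]
  have h01 : contentEntry (gY 1 (fun _ => (1 : ℤ)) (fun _ => 0) (fun _ => 0))
      (gZ 1 (fun _ => 0) fun _ => 0) (fun d => inducedA columnTwo ⊥ flagA d 1)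
      (fun d => inducedB columnTwo ⊥ (flagB columnTwo 1) d 1) (-1) 0 = 0 := by
    rw [contentEntry, eSuper_interval_congr _ _ (a' := 1) (b' := 2) (c' := 1) (d' := 1)
      (k' := (2 : ℕ)) (by simp only [hA0]; norm_num) (by simp only [hB1]; norm_num)
      (by simp only [hA0]; norm_num) (by simp only [hB1]; norm_num) (by norm_num)]
    refine eSuper_eq_zero_of_card_lt _ _ hz _ fun t ht => ?_
    have htu : t = Finset.univ := (Finset.card_eq_iff_eq_univ t).1
      ((Finset.mem_powersetCard.1 ht).2.trans (by simp))
    exact ⟨⟨2, by simp⟩, htu ▸ Finset.mem_univ _, hy⟩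
  simp only [Matrix.of_apply, Fin.val_zero, Fin.val_one, Nat.cast_zero, Nat.cast_one, add_zero,
    neg_add_cancel]
  rw [h00, h01, zero_mul, zero_mul, sub_zero]

/-- Here the entry is `h_2(x_1 / β_1)`, which is `x_1^2 = 1` at `β_1 = 0`. -/
theorem knownJacobiTrudi_columnTwo (n : ℕ) (hn : 1 < n) :
    knownJacobiTrudi n columnTwo ⊥ 1 (fun _ => (1 : ℤ)) (fun _ => 0) (fun _ => 0)
      ⟨0, by omega⟩ ⟨1, hn⟩ = 1 := by
  have hk : (part columnTwo 1 : ℤ) - part ⊥ 2 - (1 : ℕ) + (2 : ℕ) = (2 : ℕ) := by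
    rw [part_bot, show part columnTwo 1 = 1 from rowLen_columnTwo (by norm_num)]
    norm_num
  have h2 : part ⊥ 2 = 0 := part_bot 2
  simp only [knownJacobiTrudi, Matrix.of_apply]
  rw [show 0 + 1 = 1 from rfl, show 1 + 1 = 2 from rfl, hk, hSuper, if_neg (by omega),
    Int.toNat_natCast, Finset.sum_range_succ, Finset.sum_eq_zero, zero_add]
  · rw [Nat.sub_self, pow_zero, one_mul, MvPolynomial.esymm_zero, map_one, mul_one,
      ← aeval_hsymm_of_injective (τ := Fin 1) (fun _ => 1) _ Sum.inl Sum.inl_injective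
        (fun _ => rfl) ?_ 2, aeval_hsymm]
    · simp
    · rintro (t | t | t) ht
      · exact absurd ⟨t, rfl⟩ ht
      · exact (h2 ▸ t : Fin 0).elim0
      · exact t.elim0
  · intro i hi
    have hi := Finset.mem_range.1 hi
    rw [MvPolynomial.esymm, map_sum, Finset.sum_eq_zero, mul_zero]
    intro t ht
    obtain ⟨j, hj⟩ : t.Nonempty := by
      rw [← Finset.card_pos, (Finset.mem_powersetCard.1 ht).2]
      omega
    rw [map_prod]
    refine Finset.prod_eq_zero hj ?_
    rw [MvPolynomial.aeval_X]
    rcases j with j | j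
    · exact neg_zero
    · rfl

theorem exists_jacobiTrudi_ne_knownJacobiTrudi :
    ∃ (lam : YoungDiagram) (m : ℕ) (x α β : ℕ → ℤ),
      jacobiTrudi (conj lam 1) lam ⊥ m x α β ≠ knownJacobiTrudi (conj lam 1) lam ⊥ m x α β := by
  refine ⟨columnTwo, 1, fun _ => 1, fun _ => 0, fun _ => 0, fun h => ?_⟩
  have h2 : 1 < conj columnTwo 1 := by
    rw [show conj columnTwo 1 = 2 from colLen_columnTwo]
    norm_num
  have := congrFun (congrFun h ⟨0, by omega⟩) ⟨1, h2⟩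
  rw [jacobiTrudi_columnTwo _ h2, knownJacobiTrudi_columnTwo _ h2] at this
  exact zero_ne_one this

end Comparison

end DualGroth

theorem mainTheorem10 :
    (∀ (R : Type*) [CommRing R] (lam mu : YoungDiagram), mu ≤ lam →
      ∀ (m : ℕ) (x α β : ℕ → R) (N n : ℕ),
        DualGroth.part lam 1 ≤ N → DualGroth.conj lam 1 ≤ n →
        DualGroth.dualGroth N lam mu m x α β =
          (DualGroth.jacobiTrudi n lam mu m x α β).det) ∧
    (∃ (lam : YoungDiagram) (m : ℕ) (x α β : ℕ → ℤ),
      DualGroth.jacobiTrudi (DualGroth.conj lam 1) lam ⊥ m x α β ≠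
        DualGroth.knownJacobiTrudi (DualGroth.conj lam 1) lam ⊥ m x α β) :=
  ⟨fun _ _ lam mu hle m x α β N n hN hn =>
      DualGroth.dualGroth_eq_det_jacobiTrudi m x α β n N lam mu hle hN hn,
    DualGroth.exists_jacobiTrudi_ne_knownJacobiTrudi⟩
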